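/- Let $d\ge 2$ be an integer, $\alpha>0$ and $\beta,s\in(0,\infty)$. Let $R$ be a $[0,\infty)$-valued random variable with absolutely continuous distribution such that $\lim_{h\to\infty}h^{s}\,\mathbb P(R>h)=\beta$. For each integer $n\ge 1$ let $\mathbb T_n$ be the torus obtained from the cube $[-n/2,n/2]^d$ by identifying opposite faces, let $|\xi|$ denote the toroidal (Euclidean) distance of $\xi\in\mathbb T_n$ from the origin $o$, and let $X^{(n)}$ be a homogeneous Poisson point process on $\mathbb T_n$ with intensity $1$ that is independently marked, with marks distributed as $R$. Put $$D^{(\alpha)}_{\mathrm{in},n}=\sum_{(\xi,r)\in X^{(n)}}|\xi|^{\alpha}\,\mathbf 1\{|\xi|\le r\},$$ the sum of the $\alpha$-th powers of the lengths of all edges arriving at $o$ when each point $(\xi,r)$ sends edges to all vertices in the closed ball of radius $r$ around $\xi$. Let $\kappa_d$ be the volume of the unit ball in $\mathbb R^d$. Then $\mathbb E D^{(\alpha)}_{\mathrm{in},n}<\infty$ for all $n\ge1$, and the following hold. 1. If $s>\alpha+d$, then $\mathbb E R^{\alpha+d}<\infty$ and $\displaystyle\lim_{n\to\infty}\mathbb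 E D^{(\alpha)}_{\mathrm{in},n}=\frac{d\kappa_d}{\alpha+d}\,\mathbb E R^{\alpha+d}$. 2. If $s=\alpha+d$, then $\displaystyle\lim_{n\to\infty}(\log n)^{-1}\,\mathbb E D^{(\alpha)}_{\mathrm{in},n}=d\kappa_d\beta$. 3. If $s<\alpha+d$, then $\int_{[-1/2,1/2]^d}|\eta|^{\alpha-s}\,\mathrm d\eta<\infty$ and $\displaystyle\lim_{n\to\infty}n^{s-\alpha-d}\,\mathbb E D^{(\alpha)}_{\mathrm{in},n}=\beta\int_{[-1/2,1/2]^d}|\eta|^{\alpha-s}\,\mathrm d\eta$. -/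

import Mathlib

open MeasureTheory ProbabilityTheory Filter Topology
open scoped NNReal ENNReal

namespace ScaleFreeGilbert

noncomputable section

/-- The torus of side length `n` in dimension `d`, i.e. `(ℝ / nℤ) ^ d`: the cube
`[-n/2, n/2] ^ d` with opposite faces identified. Its origin is `0`. -/
abbrev Torus (d n : ℕ) : Type := Fin d → AddCircle (n : ℝ)

/-- The toroidal (Euclidean) distance. On each coordinate `‖x i - y i‖` is the distance from a
representative of `x i - y i` to the nearest multiple of `n`. -/
def torusDist {d n : ℕ} (x y : Torus d n) : ℝ := √(∑ i, ‖x i - y i‖ ^ 2)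

/-- Lebesgue measure on the torus: the image of Lebesgue measure on the cube `[-n/2, n/2] ^ d`
under the projection that identifies opposite faces. -/
def torusVolume (d n : ℕ) : Measure (Torus d n) :=
  ((volume : Measure (Fin d → ℝ)).restrict
    (Set.univ.pi fun _ => Set.Icc (-(n : ℝ) / 2) ((n : ℝ) / 2))).map
      fun x i => ((x i : ℝ) : AddCircle (n : ℝ))

/-- The random measure `Φ` is a Poisson process with (σ-finite) intensity measure `Λ`:
the mass of `B` is Poisson distributed with mean `Λ B` (and is almost surely infinite when
`Λ B = ∞`), and the masses of pairwise disjoint sets are independent. -/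
structure IsPoissonProcess {Ω E : Type*} [MeasurableSpace Ω] [MeasurableSpace E]
    (Φ : Ω → Measure E) (Λ : Measure E) (P : Measure Ω) : Prop where
  measurable : Measurable Φ
  map_eq : ∀ B : Set E, MeasurableSet B → Λ B ≠ ∞ →
    P.map (fun ω => Φ ω B) = (poissonMeasure (Λ B).toNNReal).map (fun k : ℕ => (k : ℝ≥0∞))
  eq_top : ∀ B : Set E, MeasurableSet B → Λ B = ∞ → ∀ᵐ ω ∂P, Φ ω B = ∞
  iIndepFun : ∀ (m : ℕ) (B : Fin m → Set E), (∀ i, MeasurableSet (B i)) →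
    Pairwise (Function.onFun Disjoint B) → iIndepFun (fun i ω => Φ ω (B i)) P

/-- A random finite family of marked points: the points `(point i ω, mark i ω)`,
`i < card ω`, where `point i ω` is the location and `mark i ω` is the mark. -/
structure MarkedPoints (Ω E M : Type*) where
  card : Ω → ℕ
  point : ℕ → Ω → E
  mark : ℕ → Ω → M

/-- The (unmarked) point process formed by the locations. -/
def MarkedPoints.ground {Ω E M : Type*} [MeasurableSpace E] (X : MarkedPoints Ω E M) (ω : Ω) :
    Measure E :=
  ∑ i ∈ Finset.range (X.card ω), Measure.dirac (X.point i ω)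

/-- `X` is an independently marked Poisson process with intensity measure `Λ` and mark
distribution `ν`: the locations form a Poisson process with intensity measure `Λ`, and the
marks are independent with law `ν`, and independent of the family of locations. -/
structure MarkedPoints.IsIndepMarkedPoisson {Ω E M : Type*} [MeasurableSpace Ω]
    [MeasurableSpace E] [MeasurableSpace M] (X : MarkedPoints Ω E M) (Λ : Measure E)
    (ν : Measure M) (P : Measure Ω) : Prop where
  measurable_card : Measurable X.card
  measurable_point : ∀ i, Measurable (X.point i)
  measurable_mark : ∀ i, Measurable (X.mark i)
  ground_poisson : IsPoissonProcess X.ground Λ P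
  map_mark : ∀ i, P.map (X.mark i) = ν
  iIndepFun_mark : iIndepFun X.mark P
  indepFun_mark : IndepFun (fun ω => (X.card ω, fun i => X.point i ω)) (fun ω i => X.mark i ω) P

open Classical in
/-- The sum of the `α`-th powers of the lengths of all edges arriving at the origin: the point
`(ξ, r)` contributes `|ξ| ^ α` if `ξ` lies in the closed ball of radius `r` around the origin. -/
def inDegree {Ω : Type*} {d n : ℕ} (α : ℝ) (X : MarkedPoints Ω (Torus d n) ℝ≥0) (ω : Ω) : ℝ :=
  ∑ i ∈ Finset.range (X.card ω),
    if torusDist (X.point i ω) 0 ≤ (X.mark i ω : ℝ) then torusDist (X.point i ω) 0 ^ α else 0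

/-- The volume `κ_d` of the unit ball in `ℝ ^ d`. -/
def unitBallVolume (d : ℕ) : ℝ :=
  volume.real (Metric.closedBall (0 : EuclideanSpace ℝ (Fin d)) 1)

/-- The cube `[-1/2, 1/2] ^ d`. -/
def unitCube (d : ℕ) : Set (EuclideanSpace ℝ (Fin d)) :=
  {η | ∀ i, η i ∈ Set.Icc (-(1 / 2) : ℝ) (1 / 2)}

end

end ScaleFreeGilbert

namespace ScaleFreeGilbert

/-! Write `G t = ℙ(R ≥ t)`. Campbell's formula integrates out the marks and the points, so the mean
in-degree is the integral of `‖η‖ ^ α * G ‖η‖` over the cube of side `n`. The law of `R` has no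
atoms, hence `t ^ s * G t → β`. In polar coordinates the radial integrand behaves like `β * y ^ (α +
d - 1 - s)`, and the three cases are the behaviour of this power at infinity.

If `s > α + d`, the integrand is integrable on the whole space; the cubes exhaust the space and the
layer-cake formula turns the limit into a moment of `R`. If `s = α + d`, the radial integrand is
asymptotic to `β / y`, which gives a logarithm; the cube lies between two balls of radius
proportional to `n`, and the factors do not affect the limit. If `s < α + d`, rescaling to the unit
cube extracts the power of `n`, and dominated convergence replaces `t ^ s * G t` by `β`. -/

/-! ### Mean measure and Campbell's formula -/

lemma lintegral_natCast_poissonMeasure (r : ℝ≥0) :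
    ∫⁻ k : ℕ, (k : ℝ≥0∞) ∂poissonMeasure r = r := by
  have hs : HasSum (fun k : ℕ => Real.exp (-r) * (r : ℝ) ^ k / k.factorial * k) r := by
    rw [← hasSum_nat_add_iff' 1]
    have h := (hasSum_one_poissonMeasure r).mul_left (r : ℝ)
    simp only [Finset.range_one, Finset.sum_singleton, CharP.cast_eq_zero, mul_zero, sub_zero]
    rw [mul_one] at h
    refine h.congr_fun fun k => ?_
    rw [Nat.factorial_succ]
    push_cast
    field_simp
    ring
  rw [poissonMeasure, lintegral_sum_measure]
  simp only [lintegral_smul_measure, lintegral_dirac, smul_eq_mul]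
  have : ∀ k : ℕ, ENNReal.ofReal (Real.exp (-r) * (r : ℝ) ^ k / k.factorial) * (k : ℝ≥0∞) =
      ENNReal.ofReal (Real.exp (-r) * (r : ℝ) ^ k / k.factorial * k) := fun k => by
    rw [ENNReal.ofReal_mul (by positivity), ENNReal.ofReal_natCast]
  simp only [this]
  rw [← ENNReal.ofReal_tsum_of_nonneg (fun k => by positivity) hs.summable, hs.tsum_eq,
    ENNReal.ofReal_coe_nnreal]

/-- The mean measure of a Poisson process is its intensity measure. -/
lemma IsPoissonProcess.bind_eq {Ω E : Type*} [MeasurableSpace Ω] [MeasurableSpace E]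
    {Φ : Ω → Measure E} {Λ : Measure E} {P : Measure Ω} [IsProbabilityMeasure P]
    (h : IsPoissonProcess Φ Λ P) : P.bind Φ = Λ := by
  ext B hB
  rw [Measure.bind_apply hB h.measurable.aemeasurable]
  by_cases hΛ : Λ B = ∞
  · rw [lintegral_congr_ae (h.eq_top B hB hΛ), hΛ]
    simp
  · have hm : Measurable fun ω => Φ ω B := (Measure.measurable_coe hB).comp h.measurable
    calc ∫⁻ ω, Φ ω B ∂P = ∫⁻ x, x ∂P.map (fun ω => Φ ω B) :=
          (lintegral_map measurable_id hm).symm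
      _ = ∫⁻ k : ℕ, (k : ℝ≥0∞) ∂poissonMeasure (Λ B).toNNReal := by
          rw [h.map_eq B hB hΛ, lintegral_map (f := fun x => x) measurable_id .of_discrete]
      _ = Λ B := by rw [lintegral_natCast_poissonMeasure, ENNReal.coe_toNNReal hΛ]

/-- Campbell's formula for an independently marked Poisson process. -/
lemma MarkedPoints.IsIndepMarkedPoisson.lintegral_sum {Ω E M : Type*} [MeasurableSpace Ω]
    [MeasurableSpace E] [MeasurableSpace M] {X : MarkedPoints Ω E M} {Λ : Measure E}
    {ν : Measure M} {P : Measure Ω} [IsProbabilityMeasure P]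
    (h : X.IsIndepMarkedPoisson Λ ν P) {f : E × M → ℝ≥0∞} (hf : Measurable f) :
    ∫⁻ ω, ∑ i ∈ Finset.range (X.card ω), f (X.point i ω, X.mark i ω) ∂P =
      ∫⁻ x, ∫⁻ r, f (x, r) ∂ν ∂Λ := by
  have hν : IsProbabilityMeasure ν := by
    rw [← h.map_mark 0]
    exact Measure.isProbabilityMeasure_map (h.measurable_mark 0).aemeasurable
  have hF : Measurable fun x => ∫⁻ r, f (x, r) ∂ν := hf.lintegral_prod_right'
  -- A sum of random length becomes a series over all `i` with the indicator of `i < card`, so that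
  -- sum and expectation can be exchanged.
  have key : ∀ a : ℕ → Ω → ℝ≥0∞, (∀ i, Measurable (a i)) →
      ∫⁻ ω, ∑ i ∈ Finset.range (X.card ω), a i ω ∂P =
        ∑' i, ∫⁻ ω, {ω | i < X.card ω}.indicator (a i) ω ∂P := fun a ha => by
    rw [← lintegral_tsum fun i =>
      ((ha i).indicator (measurableSet_lt measurable_const h.measurable_card)).aemeasurable]
    refine lintegral_congr fun ω => ?_
    rw [tsum_eq_sum (s := Finset.range (X.card ω)) fun i hi => by
      simpa [Set.indicator] using fun h' => absurd h' (by simpa using hi)]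
    refine Finset.sum_congr rfl fun i hi => ?_
    rw [Set.indicator_of_mem (by simpa using hi)]
  rw [key (fun i ω => f (X.point i ω, X.mark i ω))
    fun i => hf.comp ((h.measurable_point i).prodMk (h.measurable_mark i))]
  -- Mark `i` is independent of the pair `(card, point i)`, so it can be averaged out while the
  -- event `i < card` stays in place. No law of an individual point is needed.
  have step : ∀ i, ∫⁻ ω, {ω | i < X.card ω}.indicator (fun ω => f (X.point i ω, X.mark i ω)) ω ∂P
      = ∫⁻ ω, {ω | i < X.card ω}.indicator (fun ω => ∫⁻ r, f (X.point i ω, r) ∂ν) ω ∂P := by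
    intro i
    have hY : Measurable fun ω => (X.card ω, X.point i ω) :=
      h.measurable_card.prodMk (h.measurable_point i)
    have hind : IndepFun (fun ω => (X.card ω, X.point i ω)) (X.mark i) P :=
      h.indepFun_mark.comp (φ := fun p : ℕ × (ℕ → E) => (p.1, p.2 i))
        (ψ := fun m : ℕ → M => m i) (by fun_prop) (by fun_prop)
    have hmap := hind.map_prod_eq_prod_map_map hY.aemeasurable (h.measurable_mark i).aemeasurable
    rw [h.map_mark i] at hmap
    have hS : MeasurableSet {q : ℕ × E | i < q.1} := measurableSet_lt measurable_const measurable_fst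
    have hS' : MeasurableSet {q : (ℕ × E) × M | i < q.1.1} :=
      measurableSet_lt measurable_const (by fun_prop)
    have hg : Measurable ({q : (ℕ × E) × M | i < q.1.1}.indicator fun q => f (q.1.2, q.2)) :=
      (hf.comp (by fun_prop)).indicator hS'
    have hg' : Measurable ({q : ℕ × E | i < q.1}.indicator fun q => ∫⁻ r, f (q.2, r) ∂ν) :=
      (hF.comp measurable_snd).indicator hS
    calc _ = ∫⁻ q, {q : (ℕ × E) × M | i < q.1.1}.indicator (fun q => f (q.1.2, q.2)) q
            ∂P.map (fun ω => ((X.card ω, X.point i ω), X.mark i ω)) :=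
          (lintegral_map hg (hY.prodMk (h.measurable_mark i))).symm
      _ = ∫⁻ q, {q : ℕ × E | i < q.1}.indicator (fun q => ∫⁻ r, f (q.2, r) ∂ν) q
            ∂P.map (fun ω => (X.card ω, X.point i ω)) := by
          rw [hmap, lintegral_prod _ hg.aemeasurable]
          refine lintegral_congr fun q => ?_
          by_cases hq : i < q.1 <;> simp [Set.indicator, hq]
      _ = _ := lintegral_map hg' hY
  simp only [step]
  rw [← key (fun i ω => ∫⁻ r, f (X.point i ω, r) ∂ν) fun i => hF.comp (h.measurable_point i),
    ← h.ground_poisson.bind_eq, Measure.lintegral_bind h.ground_poisson.measurable.aemeasurable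
      hF.aemeasurable]
  refine lintegral_congr fun ω => ?_
  rw [MarkedPoints.ground, lintegral_finsetSum_measure]
  refine Finset.sum_congr rfl fun i _ => ?_
  rw [lintegral_dirac' _ hF]

/-! ### Cubes and the toroidal distance -/

/-- The cube `[-a/2, a/2] ^ d`. -/
def centeredCube (d : ℕ) (a : ℝ) : Set (EuclideanSpace ℝ (Fin d)) :=
  {η | ∀ i, η i ∈ Set.Icc (-a / 2) (a / 2)}

lemma centeredCube_one (d : ℕ) : centeredCube d 1 = unitCube d := by
  ext η
  simp only [centeredCube, unitCube, Set.mem_ofPred_eq, neg_div]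

lemma measurableSet_centeredCube (d : ℕ) (a : ℝ) : MeasurableSet (centeredCube d a) := by
  have : centeredCube d a = ⋂ i, (fun η : EuclideanSpace ℝ (Fin d) => η i) ⁻¹'
      Set.Icc (-a / 2) (a / 2) := by
    ext η
    simp [centeredCube]
  rw [this]
  exact MeasurableSet.iInter fun i => (by fun_prop : Measurable _) measurableSet_Icc

lemma abs_apply_le_of_mem_centeredCube {d : ℕ} {a : ℝ} {η : EuclideanSpace ℝ (Fin d)}
    (h : η ∈ centeredCube d a) (i : Fin d) : |η i| ≤ a / 2 :=
  abs_le.2 ⟨by have := (h i).1; linarith, (h i).2⟩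

/-- The sharp factor `√d / 2` is not needed: the bound serves only boundedness and a comparison with
balls on a logarithmic scale. -/
lemma norm_le_of_mem_centeredCube {d : ℕ} {a : ℝ} (ha : 0 ≤ a) {η : EuclideanSpace ℝ (Fin d)}
    (h : η ∈ centeredCube d a) : ‖η‖ ≤ d * a := by
  rw [EuclideanSpace.norm_eq]
  refine Real.sqrt_le_iff.2 ⟨by positivity, ?_⟩
  calc ∑ i, ‖η i‖ ^ 2 ≤ ∑ _i : Fin d, a ^ 2 := by
        refine Finset.sum_le_sum fun i _ => ?_
        have := abs_apply_le_of_mem_centeredCube h i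
        rw [Real.norm_eq_abs]
        gcongr
        linarith
    _ = d * a ^ 2 := by simp
    _ ≤ (d * a) ^ 2 := by
        rw [mul_pow]
        gcongr
        exact_mod_cast Nat.le_self_pow two_ne_zero d

lemma ball_subset_centeredCube (d : ℕ) (a : ℝ) :
    Metric.ball (0 : EuclideanSpace ℝ (Fin d)) (a / 2) ⊆ centeredCube d a := by
  intro η hη i
  rw [mem_ball_zero_iff] at hη
  have := (PiLp.norm_apply_le η i).trans hη.le
  rw [Real.norm_eq_abs, abs_le] at this
  exact ⟨by linarith [this.1], this.2⟩

lemma centeredCube_subset_ball {d : ℕ} {a : ℝ} (ha : 0 < a) :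
    centeredCube d a ⊆ Metric.ball (0 : EuclideanSpace ℝ (Fin d)) ((d + 1) * a) := by
  intro η hη
  rw [mem_ball_zero_iff]
  linarith [norm_le_of_mem_centeredCube ha.le hη]

lemma volume_centeredCube_ne_top (d : ℕ) {a : ℝ} (ha : 0 < a) :
    volume (centeredCube d a) ≠ ∞ :=
  ((measure_mono (centeredCube_subset_ball ha)).trans_lt measure_ball_lt_top).ne

lemma measurable_torusDist_zero {d n : ℕ} : Measurable fun x : Torus d n => torusDist x 0 := by
  unfold torusDist
  fun_prop

lemma torusDist_nonneg {d n : ℕ} (x y : Torus d n) : 0 ≤ torusDist x y := Real.sqrt_nonneg _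

/-- In the cube every coordinate is at most half a period in absolute value, so `0` is a nearest
multiple of `n`, also on the boundary. -/
lemma torusDist_coe {d n : ℕ} (hn : 1 ≤ n) {η : EuclideanSpace ℝ (Fin d)}
    (h : η ∈ centeredCube d n) :
    torusDist (fun i => ((η i : ℝ) : AddCircle (n : ℝ))) 0 = ‖η‖ := by
  rw [torusDist, EuclideanSpace.norm_eq]
  congr 1
  refine Finset.sum_congr rfl fun i _ => ?_
  rw [Pi.zero_apply, sub_zero, Real.norm_eq_abs, (AddCircle.norm_coe_eq_abs_iff _ (by positivity)).2]
  rw [Nat.abs_cast]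
  exact abs_apply_le_of_mem_centeredCube h i

/-- Radial functions on the torus integrate as radial functions on the cube. -/
lemma lintegral_torusVolume {d n : ℕ} (hn : 1 ≤ n) {g : ℝ → ℝ≥0∞} (hg : Measurable g) :
    ∫⁻ x, g (torusDist x 0) ∂torusVolume d n =
      ∫⁻ η in centeredCube d n, g ‖η‖ := by
  have hproj : Measurable fun (x : Fin d → ℝ) (i : Fin d) => ((x i : ℝ) : AddCircle (n : ℝ)) :=
    measurable_pi_lambda _ fun i =>
      (AddCircle.continuous_mk' (n : ℝ)).measurable.comp (measurable_pi_apply i)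
  have hgd : Measurable fun x : Torus d n => g (torusDist x 0) := hg.comp measurable_torusDist_zero
  rw [torusVolume, lintegral_map hgd hproj]
  have hpre : (WithLp.ofLp : EuclideanSpace ℝ (Fin d) → Fin d → ℝ) ⁻¹'
      (Set.univ.pi fun _ => Set.Icc (-(n : ℝ) / 2) ((n : ℝ) / 2)) = centeredCube d n := by
    ext η
    simp only [centeredCube, Set.mem_preimage, Set.mem_univ_pi, Set.mem_ofPred_eq]
  -- The torus is built from `Fin d → ℝ`, whose norm is the sup norm; the identity map from
  -- Euclidean space preserves volume.
  have hcomp := (PiLp.volume_preserving_ofLp (Fin d)).setLIntegral_comp_preimage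
    (s := Set.univ.pi fun _ => Set.Icc (-(n : ℝ) / 2) ((n : ℝ) / 2))
    (MeasurableSet.univ_pi fun _ => measurableSet_Icc) (hgd.comp hproj)
  rw [hpre] at hcomp
  refine hcomp.symm.trans ?_
  refine setLIntegral_congr_fun (measurableSet_centeredCube d n) fun η hη => ?_
  exact congrArg g (torusDist_coe hn hη)

lemma integrableOn_centeredCube {d : ℕ} {a : ℝ} (ha : 0 < a) {α : ℝ} (hα : 0 ≤ α) {G : ℝ → ℝ}
    (hG : Antitone G) (hG0 : ∀ t, 0 ≤ G t) (hG1 : ∀ t, G t ≤ 1) :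
    IntegrableOn (fun η : EuclideanSpace ℝ (Fin d) => ‖η‖ ^ α * G ‖η‖) (centeredCube d a) := by
  have hm := hG.measurable
  refine Measure.integrableOn_of_bounded (M := (d * a) ^ α) (volume_centeredCube_ne_top d ha)
    (by fun_prop) ?_
  filter_upwards [ae_restrict_mem (measurableSet_centeredCube d a)] with η hη
  have h1 : ‖η‖ ^ α ≤ (d * a) ^ α :=
    Real.rpow_le_rpow (norm_nonneg _) (norm_le_of_mem_centeredCube ha.le hη) hα
  have h0 : 0 ≤ ‖η‖ ^ α := by positivity
  rw [Real.norm_of_nonneg (mul_nonneg h0 (hG0 _))]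
  exact (mul_le_of_le_one_right h0 (hG1 _)).trans h1

/-! ### The mean in-degree as an integral over the cube -/

lemma inDegree_nonneg {Ω : Type*} {d n : ℕ} {X : MarkedPoints Ω (Torus d n) ℝ≥0} (α : ℝ) (ω : Ω) :
    0 ≤ inDegree α X ω := by
  refine Finset.sum_nonneg fun i _ => ?_
  split_ifs
  · exact Real.rpow_nonneg (torusDist_nonneg _ _) _
  · exact le_rfl

lemma measurable_inDegree {Ω : Type*} [MeasurableSpace Ω] {P : Measure Ω} {d n : ℕ}
    {X : MarkedPoints Ω (Torus d n) ℝ≥0} (α : ℝ) {Λ : Measure (Torus d n)} {ν : Measure ℝ≥0}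
    (hX : X.IsIndepMarkedPoisson Λ ν P) : Measurable (inDegree α X) := by
  classical
  have hp : ∀ i, Measurable fun ω => torusDist (X.point i ω) 0 := fun i =>
    measurable_torusDist_zero.comp (hX.measurable_point i)
  have hs : ∀ k : ℕ, Measurable fun ω => ∑ i ∈ Finset.range k,
      if torusDist (X.point i ω) 0 ≤ (X.mark i ω : ℝ) then torusDist (X.point i ω) 0 ^ α
        else 0 := fun k =>
    Finset.measurable_fun_sum _ fun i _ => Measurable.ite
      (measurableSet_le (hp i) (hX.measurable_mark i).coe_nnreal_real) ((hp i).pow_const α)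
      measurable_const
  -- The number of summands is random but takes countably many values, so measurability for each
  -- fixed number suffices.
  have := (measurable_from_prod_countable_right (f := fun q : ℕ × Ω => ∑ i ∈ Finset.range q.1,
      if torusDist (X.point i q.2) 0 ≤ (X.mark i q.2 : ℝ) then torusDist (X.point i q.2) 0 ^ α
        else 0) hs).comp (hX.measurable_card.prodMk measurable_id)
  convert this using 1
  ext ω
  simp [inDegree]

section Mark

variable {Ω₀ : Type*} [MeasurableSpace Ω₀] (P₀ : Measure Ω₀) (R : Ω₀ → ℝ≥0)

/-- The tail function `t ↦ ℙ(t ≤ R)` of the mark. -/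
noncomputable def tailFun (t : ℝ) : ℝ := P₀.real {ω | t ≤ (R ω : ℝ)}

lemma tailFun_nonneg (t : ℝ) : 0 ≤ tailFun P₀ R t := measureReal_nonneg

lemma tailFun_le_one [IsProbabilityMeasure P₀] (t : ℝ) : tailFun P₀ R t ≤ 1 := measureReal_le_one

lemma antitone_tailFun [IsProbabilityMeasure P₀] : Antitone (tailFun P₀ R) := fun _ _ h =>
  measureReal_mono fun _ hω => h.trans hω

variable {P₀ R}

/-- Closed balls produce `t ≤ R`, the tail hypothesis has `t < R`; absolute continuity excludes an
atom at `t`. -/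
lemma tailFun_eq (hR : Measurable R) (hR_ac : P₀.map (fun ω => (R ω : ℝ)) ≪ volume)
    (t : ℝ) : tailFun P₀ R t = P₀.real {ω | t < (R ω : ℝ)} := by
  have h0 : P₀ {ω | (R ω : ℝ) = t} = 0 := by
    have := hR_ac (measure_singleton t)
    rwa [Measure.map_apply (by fun_prop) (measurableSet_singleton t)] at this
  refine measureReal_congr ?_
  have h1 : ∀ᵐ ω ∂P₀, (R ω : ℝ) ≠ t := by
    rw [ae_iff]
    simpa using h0
  filter_upwards [h1] with ω hω
  exact propext ⟨fun h => lt_of_le_of_ne h (Ne.symm hω), fun h => le_of_lt h⟩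

variable [IsProbabilityMeasure P₀] {Ω : Type*} [MeasurableSpace Ω] {P : Measure Ω}
  [IsProbabilityMeasure P] {d n : ℕ} {X : MarkedPoints Ω (Torus d n) ℝ≥0}

lemma lintegral_inDegree (hR : Measurable R) (hn : 1 ≤ n) (α : ℝ)
    (hX : X.IsIndepMarkedPoisson (torusVolume d n) (P₀.map R) P) :
    ∫⁻ ω, ENNReal.ofReal (inDegree α X ω) ∂P =
      ∫⁻ η in centeredCube d n, ENNReal.ofReal (‖η‖ ^ α * tailFun P₀ R ‖η‖) := by
  classical
  have hG := (antitone_tailFun P₀ R).measurable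
  set f : Torus d n × ℝ≥0 → ℝ≥0∞ := fun q =>
    {q : Torus d n × ℝ≥0 | torusDist q.1 0 ≤ (q.2 : ℝ)}.indicator
      (fun q => ENNReal.ofReal (torusDist q.1 0 ^ α)) q with hf_def
  have hd : Measurable fun q : Torus d n × ℝ≥0 => torusDist q.1 0 :=
    measurable_torusDist_zero.comp measurable_fst
  have hf : Measurable f :=
    (hd.pow_const α).ennreal_ofReal.indicator (measurableSet_le hd (by fun_prop))
  have h1 : ∀ ω, ENNReal.ofReal (inDegree α X ω) =
      ∑ i ∈ Finset.range (X.card ω), f (X.point i ω, X.mark i ω) := fun ω => by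
    rw [inDegree, ENNReal.ofReal_sum_of_nonneg]
    · refine Finset.sum_congr rfl fun i _ => ?_
      by_cases h : torusDist (X.point i ω) 0 ≤ (X.mark i ω : ℝ) <;> simp [hf_def, h]
    · intro i _
      split_ifs
      · exact Real.rpow_nonneg (torusDist_nonneg _ _) _
      · exact le_rfl
  simp only [h1]
  rw [hX.lintegral_sum hf, ← lintegral_torusVolume hn
    (g := fun t => ENNReal.ofReal (t ^ α * tailFun P₀ R t)) (by fun_prop)]
  refine lintegral_congr fun x => ?_
  have hS : MeasurableSet {r : ℝ≥0 | torusDist x 0 ≤ (r : ℝ)} :=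
    measurableSet_le measurable_const (by fun_prop)
  have h2 : (fun r => f (x, r)) = {r : ℝ≥0 | torusDist x 0 ≤ (r : ℝ)}.indicator
      fun _ => ENNReal.ofReal (torusDist x 0 ^ α) := by
    ext r
    by_cases h : torusDist x 0 ≤ (r : ℝ) <;> simp [hf_def, h]
  rw [h2, lintegral_indicator_const hS, Measure.map_apply hR hS,
    ENNReal.ofReal_mul (Real.rpow_nonneg (torusDist_nonneg _ _) _), tailFun,
    ofReal_measureReal (measure_ne_top _ _)]
  rfl

lemma integrable_inDegree (hR : Measurable R) (hn : 1 ≤ n) {α : ℝ} (hα : 0 ≤ α)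
    (hX : X.IsIndepMarkedPoisson (torusVolume d n) (P₀.map R) P) :
    Integrable (inDegree α X) P := by
  refine ⟨(measurable_inDegree α hX).aestronglyMeasurable, ?_⟩
  rw [hasFiniteIntegral_iff_ofReal (ae_of_all _ fun ω => inDegree_nonneg α ω),
    lintegral_inDegree hR hn α hX]
  exact (integrableOn_centeredCube (by positivity) hα (antitone_tailFun P₀ R)
    (tailFun_nonneg P₀ R) (tailFun_le_one P₀ R)).lintegral_lt_top

lemma integral_inDegree (hR : Measurable R) (hn : 1 ≤ n) (α : ℝ)
    (hX : X.IsIndepMarkedPoisson (torusVolume d n) (P₀.map R) P) :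
    ∫ ω, inDegree α X ω ∂P =
      ∫ η in centeredCube d n, ‖η‖ ^ α * tailFun P₀ R ‖η‖ := by
  have hG := (antitone_tailFun P₀ R).measurable
  rw [integral_eq_lintegral_of_nonneg_ae (ae_of_all _ fun ω => inDegree_nonneg α ω)
      (measurable_inDegree α hX).aestronglyMeasurable, lintegral_inDegree hR hn α hX,
    integral_eq_lintegral_of_nonneg_ae
      (ae_of_all _ fun η => mul_nonneg (by positivity) (tailFun_nonneg P₀ R _)) (by fun_prop)]

end Mark

/-! ### Growing cubes and tail exponents below `α + d` -/

lemma monotone_centeredCube (d : ℕ) : Monotone (centeredCube d) := fun a b hab η hη i =>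
  ⟨by have := (hη i).1; linarith, by have := (hη i).2; linarith⟩

lemma iUnion_centeredCube_natCast (d : ℕ) : ⋃ n : ℕ, centeredCube d n = Set.univ := by
  refine Set.eq_univ_of_forall fun η => Set.mem_iUnion.2 ?_
  obtain ⟨n, hn⟩ := exists_nat_gt (‖η‖ * 2)
  exact ⟨n, ball_subset_centeredCube d n (mem_ball_zero_iff.2 (by linarith))⟩

open scoped Pointwise in
lemma smul_unitCube {d : ℕ} {a : ℝ} (ha : 0 < a) : a • unitCube d = centeredCube d a := by
  ext η
  rw [Set.mem_smul_set_iff_inv_smul_mem₀ ha.ne']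
  simp only [unitCube, centeredCube, Set.mem_ofPred_eq, PiLp.smul_apply, smul_eq_mul, Set.mem_Icc]
  refine forall_congr' fun i => ?_
  rw [inv_mul_eq_div, le_div_iff₀ ha, div_le_iff₀ ha]
  constructor <;> rintro ⟨h1, h2⟩ <;> constructor <;> linarith

lemma unitBallVolume_eq_ball {d : ℕ} (hd : 1 ≤ d) :
    (volume : Measure (EuclideanSpace ℝ (Fin d))).real (Metric.ball 0 1) = unitBallVolume d := by
  have : Nonempty (Fin d) := ⟨⟨0, hd⟩⟩
  rw [unitBallVolume, measureReal_def, measureReal_def, Measure.addHaar_closedBall_eq_addHaar_ball]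

/-- The function `t ↦ t ^ s * G t` is bounded on `(0, ∞)`. -/
lemma exists_forall_rpow_mul_le {G : ℝ → ℝ} (hG1 : ∀ t, G t ≤ 1) {s β : ℝ}
    (hs : 0 < s) (hlim : Tendsto (fun t : ℝ => t ^ s * G t) atTop (𝓝 β)) :
    ∃ C, ∀ t, 0 ≤ t → t ^ s * G t ≤ C := by
  obtain ⟨T, hT⟩ := eventually_atTop.1 (hlim.eventually_le_const (lt_add_one β))
  refine ⟨max (β + 1) (|T| ^ s), fun t ht => ?_⟩
  rcases le_total T t with h | h
  · exact (hT t h).trans (le_max_left _ _)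
  · refine le_max_of_le_right ?_
    calc t ^ s * G t ≤ t ^ s := mul_le_of_le_one_right (by positivity) (hG1 t)
      _ ≤ |T| ^ s := Real.rpow_le_rpow ht (h.trans (le_abs_self T)) hs.le

/-- Polar coordinates leave `y ^ (d - 1 + p)` on `(0, r)`, with exponent above `-1`. -/
lemma integrableOn_rpow_norm_ball {d : ℕ} (hd : 1 ≤ d) {p : ℝ} (hp : 0 < p + d) (r : ℝ) :
    IntegrableOn (fun η : EuclideanSpace ℝ (Fin d) => ‖η‖ ^ p) (Metric.ball 0 r) := by
  have : Nonempty (Fin d) := ⟨⟨0, hd⟩⟩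
  rw [integrableOn_fun_norm_addHaar volume (f := fun y => y ^ p), finrank_euclideanSpace_fin]
  rcases le_total r 0 with hr | hr
  · simp [Set.Ioo_eq_empty (not_lt.2 hr)]
  · have h := (intervalIntegral.intervalIntegrable_rpow' (a := 0) (b := r)
      (show -1 < (d : ℝ) - 1 + p by linarith)).1
    refine (h.mono_set Set.Ioo_subset_Ioc_self).congr_fun (fun y hy => ?_) measurableSet_Ioo
    simp only [smul_eq_mul]
    rw [Real.rpow_add hy.1, ← Nat.cast_pred hd, Real.rpow_natCast]

lemma integrableOn_rpow_norm_unitCube {d : ℕ} (hd : 1 ≤ d) {p : ℝ} (hp : 0 < p + d) :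
    IntegrableOn (fun η : EuclideanSpace ℝ (Fin d) => ‖η‖ ^ p) (unitCube d) := by
  rw [← centeredCube_one]
  exact (integrableOn_rpow_norm_ball hd hp _).mono_set (centeredCube_subset_ball one_pos)

/-- Asymptotics of the cube integrals if the tail exponent is small. -/
lemma tendsto_integral_centeredCube_of_lt {d : ℕ} (hd : 1 ≤ d) {G : ℝ → ℝ} (hG : Antitone G)
    (hG0 : ∀ t, 0 ≤ G t) (hG1 : ∀ t, G t ≤ 1) {α β s : ℝ} (hs : 0 < s) (hsα : s < α + d)
    (hlim : Tendsto (fun t : ℝ => t ^ s * G t) atTop (𝓝 β)) :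
    Tendsto (fun n : ℕ => (n : ℝ) ^ (s - α - d) *
        ∫ η in centeredCube d n, ‖η‖ ^ α * G ‖η‖) atTop
      (𝓝 (β * ∫ η in unitCube d, ‖η‖ ^ (α - s))) := by
  have hm := hG.measurable
  have : Nonempty (Fin d) := ⟨⟨0, hd⟩⟩
  have hmeas : MeasurableSet (unitCube d) := centeredCube_one d ▸ measurableSet_centeredCube d 1
  obtain ⟨C, hC⟩ := exists_forall_rpow_mul_le hG1 hs hlim
  have hint := integrableOn_rpow_norm_unitCube hd (show 0 < (α - s) + d by linarith)
  have hne : ∀ᵐ η : EuclideanSpace ℝ (Fin d) ∂volume.restrict (unitCube d), 0 < ‖η‖ := by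
    refine ae_restrict_of_ae ?_
    filter_upwards [measure_eq_zero_iff_ae_notMem.1
      (measure_singleton (μ := volume) (0 : EuclideanSpace ℝ (Fin d)))] with η hη
    exact norm_pos_iff.2 (by simpa using hη)
  -- Substituting `n • η` contributes `n ^ (d + α)`; the remaining `n ^ s` is paired with `‖η‖ ^ s`
  -- to form `(n * ‖η‖) ^ s`.
  have key : ∀ n : ℕ, 1 ≤ n → (n : ℝ) ^ (s - α - d) *
        ∫ η in centeredCube d n, ‖η‖ ^ α * G ‖η‖ =
      ∫ η in unitCube d, ‖η‖ ^ (α - s) * ((n * ‖η‖) ^ s * G (n * ‖η‖)) := by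
    intro n hn
    have hn' : (0 : ℝ) < n := by positivity
    have hsc := Measure.setIntegral_comp_smul_of_pos volume
      (fun η : EuclideanSpace ℝ (Fin d) => ‖η‖ ^ α * G ‖η‖) (unitCube d) hn'
    rw [smul_unitCube hn', finrank_euclideanSpace_fin, smul_eq_mul,
      eq_inv_mul_iff_mul_eq₀ (by positivity)] at hsc
    rw [← hsc, ← mul_assoc, ← integral_const_mul]
    refine integral_congr_ae ?_
    filter_upwards [hne] with η hη
    simp only [norm_smul_of_nonneg hn'.le]
    rw [Real.mul_rpow hn'.le hη.le, Real.mul_rpow hn'.le hη.le, ← Real.rpow_natCast,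
      Real.rpow_sub hη, Real.rpow_sub hn', Real.rpow_sub hn']
    have := Real.rpow_pos_of_pos hη s
    have := Real.rpow_pos_of_pos hn' α
    have := Real.rpow_pos_of_pos hn' (d : ℝ)
    field_simp
  have hmain : Tendsto (fun n : ℕ => ∫ η in unitCube d,
      ‖η‖ ^ (α - s) * ((n * ‖η‖) ^ s * G (n * ‖η‖))) atTop
      (𝓝 (∫ η in unitCube d, ‖η‖ ^ (α - s) * β)) := by
    refine tendsto_integral_of_dominated_convergence (fun η => ‖η‖ ^ (α - s) * C)
      (fun n => by fun_prop) (hint.mul_const C) (fun n => ?_) ?_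
    · refine ae_of_all _ fun η => ?_
      have h0 : 0 ≤ (n * ‖η‖) ^ s * G (n * ‖η‖) := mul_nonneg (by positivity) (hG0 _)
      rw [Real.norm_of_nonneg (mul_nonneg (by positivity) h0)]
      exact mul_le_mul_of_nonneg_left (hC _ (by positivity)) (by positivity)
    · filter_upwards [hne] with η hη
      exact (hlim.comp (tendsto_natCast_atTop_atTop.atTop_mul_const hη)).const_mul _
  rw [mul_comm, ← integral_mul_const]
  refine hmain.congr' ?_
  filter_upwards [eventually_ge_atTop 1] with n hn
  exact (key n hn).symm

/-! ### Tail exponents above `α + d` -/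

/-- `G t` is at most a constant times `(1 + t) ^ (-s)`, so `(1 + ‖η‖) ^ (-(s - α))` dominates up to
a constant, and `s - α > d`. -/
lemma integrable_rpow_norm_mul {d : ℕ} {G : ℝ → ℝ} (hG : Antitone G)
    (hG0 : ∀ t, 0 ≤ G t) (hG1 : ∀ t, G t ≤ 1) {α β s : ℝ} (hα : 0 ≤ α) (hs : 0 < s)
    (hsα : α + d < s) (hlim : Tendsto (fun t : ℝ => t ^ s * G t) atTop (𝓝 β)) :
    Integrable fun η : EuclideanSpace ℝ (Fin d) => ‖η‖ ^ α * G ‖η‖ := by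
  have hm := hG.measurable
  obtain ⟨C, hC⟩ := exists_forall_rpow_mul_le hG1 hs hlim
  have hJ := integrable_one_add_norm (E := EuclideanSpace ℝ (Fin d)) (μ := volume)
    (r := s - α) (by rw [finrank_euclideanSpace_fin]; linarith)
  refine (hJ.const_mul ((1 + C) * 2 ^ s)).mono' (by fun_prop) (ae_of_all _ fun η => ?_)
  set t := ‖η‖
  have ht : 0 ≤ t := norm_nonneg _
  have h1 : 0 < 1 + t := by linarith
  rw [Real.norm_of_nonneg (mul_nonneg (by positivity) (hG0 t))]
  have hb : (1 + t) ^ s * G t ≤ (1 + C) * 2 ^ s := by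
    have h2 : (1 + t) ^ s ≤ 2 ^ s * (1 + t ^ s) := by
      have hp : (0 : ℝ) ≤ 2 ^ s := by positivity
      have hq : 0 ≤ t ^ s := by positivity
      rcases le_total t 1 with h | h
      · calc (1 + t) ^ s ≤ 2 ^ s := Real.rpow_le_rpow h1.le (by linarith) hs.le
          _ ≤ 2 ^ s * (1 + t ^ s) := le_mul_of_one_le_right hp (by linarith)
      · calc (1 + t) ^ s ≤ (2 * t) ^ s := Real.rpow_le_rpow h1.le (by linarith) hs.le
          _ = 2 ^ s * t ^ s := Real.mul_rpow (by norm_num) ht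
          _ ≤ 2 ^ s * (1 + t ^ s) := mul_le_mul_of_nonneg_left (by linarith) hp
    calc (1 + t) ^ s * G t ≤ 2 ^ s * (1 + t ^ s) * G t := mul_le_mul_of_nonneg_right h2 (hG0 t)
      _ = 2 ^ s * (G t + t ^ s * G t) := by ring
      _ ≤ 2 ^ s * (1 + C) := by gcongr; exacts [hG1 t, hC t ht]
      _ = _ := mul_comm _ _
  calc t ^ α * G t ≤ (1 + t) ^ α * G t := by
        refine mul_le_mul_of_nonneg_right (Real.rpow_le_rpow ht (by linarith) hα) (hG0 t)
    _ = (1 + t) ^ s * G t * (1 + t) ^ (-(s - α)) := by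
        rw [mul_right_comm, ← Real.rpow_add h1]
        ring_nf
    _ ≤ _ := mul_le_mul_of_nonneg_right hb (by positivity)

/-! ### The critical exponent -/

/-- If `t * g t → β`, then the integrals of `g` grow like `β * log`. -/
lemma tendsto_intervalIntegral_div_log {g : ℝ → ℝ} {β : ℝ}
    (hg : ∀ a, 0 ≤ a → IntervalIntegrable g volume 0 a)
    (hlim : Tendsto (fun t => t * g t) atTop (𝓝 β)) :
    Tendsto (fun a => (∫ y in (0 : ℝ)..a, g y) / Real.log a) atTop (𝓝 β) := by
  rw [Metric.tendsto_atTop]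
  intro ε hε
  obtain ⟨T', hT'⟩ := Metric.tendsto_atTop.1 hlim (ε / 2) (half_pos hε)
  set T := max T' 1
  have hT1 : 1 ≤ T := le_max_right _ _
  -- `K` collects the fixed error from `[0, T]`. It is below `ε / 2 * log a` once `log a > 2 * K /
  -- ε`; on `[T, a]` comparing `g` with `β / y` costs at most another `ε / 2 * log a`.
  set K := |(∫ y in (0 : ℝ)..T, g y) - β * Real.log T| with hK
  obtain ⟨A, hA⟩ := eventually_atTop.1 (Real.tendsto_log_atTop.eventually_gt_atTop (2 * K / ε))
  refine ⟨max A (T + 1), fun a ha => ?_⟩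
  have haT : T < a := by linarith [le_max_right A (T + 1)]
  have hlog := hA a ((le_max_left _ _).trans ha)
  have hlog0 : 0 < Real.log a := Real.log_pos (by linarith)
  have hi : IntervalIntegrable g volume T a :=
    (hg T (by linarith)).symm.trans (hg a (by linarith))
  have h0 : (0 : ℝ) ∉ Set.uIcc T a := by
    rw [Set.uIcc_of_le haT.le]
    exact fun h => by linarith [h.1]
  have hinv : IntervalIntegrable (fun y : ℝ => y⁻¹) volume T a :=
    intervalIntegral.intervalIntegrable_inv (fun y hy h => h0 (h ▸ hy)) continuousOn_id
  have hloga : ∫ y in T..a, y⁻¹ = Real.log a - Real.log T := by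
    rw [integral_inv h0, Real.log_div (by linarith) (by linarith)]
  have hdiff : |(∫ y in T..a, g y) - β * (Real.log a - Real.log T)| ≤
      ε / 2 * (Real.log a - Real.log T) := by
    rw [← hloga, ← intervalIntegral.integral_const_mul, ← intervalIntegral.integral_const_mul,
      ← intervalIntegral.integral_sub hi (hinv.const_mul β), ← Real.norm_eq_abs]
    refine intervalIntegral.norm_integral_le_of_norm_le haT.le (ae_of_all _ fun y hy => ?_)
      (hinv.const_mul (ε / 2))
    have hy0 : 0 < y := by linarith [hy.1]
    have h := hT' y ((le_max_left _ _).trans hy.1.le)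
    rw [Real.dist_eq] at h
    have : g y - β * y⁻¹ = (y * g y - β) * y⁻¹ := by field_simp
    rw [this, norm_mul, Real.norm_eq_abs, Real.norm_of_nonneg (inv_pos.2 hy0).le]
    exact mul_le_mul_of_nonneg_right h.le (inv_pos.2 hy0).le
  rw [Real.dist_eq]
  have hsplit : ∫ y in (0 : ℝ)..a, g y = (∫ y in (0 : ℝ)..T, g y) + ∫ y in T..a, g y :=
    (intervalIntegral.integral_add_adjacent_intervals (hg T (by linarith)) hi).symm
  have heq : (∫ y in (0 : ℝ)..a, g y) / Real.log a - β =
      (((∫ y in (0 : ℝ)..T, g y) - β * Real.log T) +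
        ((∫ y in T..a, g y) - β * (Real.log a - Real.log T))) / Real.log a := by
    rw [hsplit]
    field_simp
    ring
  rw [heq, abs_div, abs_of_pos hlog0, div_lt_iff₀ hlog0]
  have hlT : 0 ≤ Real.log T := Real.log_nonneg hT1
  have hK2 : K < ε / 2 * Real.log a := by
    rw [div_lt_iff₀ hε] at hlog
    linarith
  have hle : ε / 2 * (Real.log a - Real.log T) ≤ ε / 2 * Real.log a := by
    gcongr
    linarith
  linarith [abs_add_le ((∫ y in (0 : ℝ)..T, g y) - β * Real.log T)
    ((∫ y in T..a, g y) - β * (Real.log a - Real.log T))]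

lemma setIntegral_ball_fun_norm {d : ℕ} (hd : 1 ≤ d) (f : ℝ → ℝ) {r : ℝ} (hr : 0 ≤ r) :
    ∫ η in Metric.ball (0 : EuclideanSpace ℝ (Fin d)) r, f ‖η‖ =
      d * unitBallVolume d * ∫ y in (0 : ℝ)..r, y ^ (d - 1) * f y := by
  have : Nonempty (Fin d) := ⟨⟨0, hd⟩⟩
  rw [← integral_indicator measurableSet_ball]
  have h1 : ((Metric.ball (0 : EuclideanSpace ℝ (Fin d)) r).indicator fun η => f ‖η‖) =
      fun η => (Set.Iio r).indicator f ‖η‖ := by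
    ext η
    simp [Set.indicator]
  rw [h1, integral_fun_norm_addHaar, finrank_euclideanSpace_fin, unitBallVolume_eq_ball hd,
    nsmul_eq_mul, smul_eq_mul, mul_assoc, intervalIntegral.integral_of_le hr,
    integral_Ioc_eq_integral_Ioo, ← Set.Ioi_inter_Iio, ← setIntegral_indicator measurableSet_Iio]
  congr 3
  ext y
  by_cases hy : y < r <;> simp [Set.indicator, hy]

/-- Asymptotics of the cube integrals at the critical tail exponent. -/
lemma tendsto_integral_centeredCube_of_eq {d : ℕ} (hd : 1 ≤ d) {G : ℝ → ℝ} (hG : Antitone G)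
    (hG0 : ∀ t, 0 ≤ G t) (hG1 : ∀ t, G t ≤ 1) {α β s : ℝ} (hα : 0 ≤ α) (hsα : s = α + d)
    (hlim : Tendsto (fun t : ℝ => t ^ s * G t) atTop (𝓝 β)) :
    Tendsto (fun n : ℕ => (Real.log n)⁻¹ *
        ∫ η in centeredCube d n, ‖η‖ ^ α * G ‖η‖) atTop
      (𝓝 (d * unitBallVolume d * β)) := by
  have hm := hG.measurable
  set g : ℝ → ℝ := fun y => y ^ (d - 1) * (y ^ α * G y) with hg_def
  have hgi : ∀ a, 0 ≤ a → IntervalIntegrable g volume 0 a := fun a ha => by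
    refine (hG.intervalIntegrable.continuousOn_mul
      (g := fun y => y ^ (d - 1) * y ^ α) ?_).congr fun y _ => mul_assoc _ _ _
    exact ((continuous_pow _).mul (Real.continuous_rpow_const hα)).continuousOn
  have hglim : Tendsto (fun t => t * g t) atTop (𝓝 β) := by
    refine hlim.congr' ?_
    filter_upwards [eventually_gt_atTop 0] with t ht
    rw [hg_def, hsα, Real.rpow_add ht, Real.rpow_natCast]
    obtain ⟨k, rfl⟩ := Nat.exists_eq_add_of_le' hd
    simp only [Nat.add_sub_cancel, pow_succ]
    ring
  have hA := tendsto_intervalIntegral_div_log hgi hglim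
  -- The limit does not depend on `c`, since `log (c * n) / log n → 1`. The values `1 / 2` and `d +
  -- 1` give the inner and outer ball of the cube.
  have hball : ∀ c : ℝ, 0 < c → Tendsto (fun n : ℕ => (Real.log n)⁻¹ *
      ∫ η in Metric.ball (0 : EuclideanSpace ℝ (Fin d)) (c * n), ‖η‖ ^ α * G ‖η‖) atTop
      (𝓝 (d * unitBallVolume d * β)) := by
    intro c hc
    have hcn : Tendsto (fun n : ℕ => c * (n : ℝ)) atTop atTop :=
      tendsto_natCast_atTop_atTop.const_mul_atTop hc
    have hlogn : Tendsto (fun n : ℕ => Real.log n) atTop atTop :=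
      Real.tendsto_log_atTop.comp tendsto_natCast_atTop_atTop
    have hlog : Tendsto (fun n : ℕ => Real.log (c * n) / Real.log n) atTop (𝓝 1) := by
      have h := (hlogn.const_div_atTop (Real.log c)).add_const 1
      rw [zero_add] at h
      refine h.congr' ?_
      filter_upwards [hlogn.eventually_gt_atTop 0, eventually_gt_atTop 0] with n hn hn0
      rw [Real.log_mul hc.ne' (by positivity), add_div, div_self hn.ne']
    have h := ((hA.comp hcn).mul hlog).const_mul (d * unitBallVolume d)
    rw [mul_one] at h
    refine h.congr' ?_
    filter_upwards [(Real.tendsto_log_atTop.comp hcn).eventually_gt_atTop 0] with n hn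
    rw [setIntegral_ball_fun_norm hd (fun y => y ^ α * G y) (by positivity)]
    simp only [Function.comp_apply] at hn ⊢
    change _ = _ * (_ * ∫ y in (0 : ℝ)..c * n, g y)
    field_simp
  have hint : ∀ a : ℝ, 0 < a → IntegrableOn
      (fun η : EuclideanSpace ℝ (Fin d) => ‖η‖ ^ α * G ‖η‖) (centeredCube d a) := fun a ha =>
    integrableOn_centeredCube ha hα hG hG0 hG1
  have hnn : ∀ η : EuclideanSpace ℝ (Fin d), 0 ≤ ‖η‖ ^ α * G ‖η‖ := fun η =>
    mul_nonneg (by positivity) (hG0 _)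
  refine tendsto_of_tendsto_of_tendsto_of_le_of_le' (hball (1 / 2) (by norm_num))
    (hball (d + 1) (by positivity)) ?_ ?_
  · filter_upwards [eventually_ge_atTop 1] with n hn
    have hn' : (0 : ℝ) < n := by positivity
    refine mul_le_mul_of_nonneg_left (setIntegral_mono_set (hint n hn') (ae_of_all _ hnn) ?_)
      (inv_nonneg.2 (Real.log_natCast_nonneg n))
    rw [one_div_mul_eq_div]
    exact (ball_subset_centeredCube d n).eventuallyLE
  · filter_upwards [eventually_ge_atTop 1] with n hn
    have hn' : (0 : ℝ) < n := by positivity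
    refine mul_le_mul_of_nonneg_left (setIntegral_mono_set ?_ (ae_of_all _ hnn)
      (centeredCube_subset_ball hn').eventuallyLE) (inv_nonneg.2 (Real.log_natCast_nonneg n))
    -- Integrability on the outer ball follows by enclosing it in a larger cube.
    refine (hint (2 * ((d + 1) * n)) (by positivity)).mono_set ?_
    have := ball_subset_centeredCube d (2 * ((d + 1) * (n : ℝ)))
    rwa [mul_div_cancel_left₀ _ two_ne_zero] at this

/-! ### The moment of the mark -/

/-- Polar coordinates and the layer-cake formula for `R ^ (α + d)` lead to the same radial integral,
with factors `d * κ_d` and `α + d`. -/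
lemma integrable_rpow_mark_and_integral_eq {d : ℕ} (hd : 1 ≤ d) {Ω₀ : Type*} [MeasurableSpace Ω₀]
    {P₀ : Measure Ω₀} [IsProbabilityMeasure P₀] {R : Ω₀ → ℝ≥0} (hR : Measurable R) {α : ℝ}
    (hα : 0 < α) (hint : Integrable fun η : EuclideanSpace ℝ (Fin d) =>
      ‖η‖ ^ α * tailFun P₀ R ‖η‖) :
    Integrable (fun ω => (R ω : ℝ) ^ (α + d)) P₀ ∧
      ∫ η : EuclideanSpace ℝ (Fin d), ‖η‖ ^ α * tailFun P₀ R ‖η‖ =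
        d * unitBallVolume d / (α + d) * ∫ ω, (R ω : ℝ) ^ (α + d) ∂P₀ := by
  have : Nonempty (Fin d) := ⟨⟨0, hd⟩⟩
  have hm := (antitone_tailFun P₀ R).measurable
  have hp : 0 < α + d := by positivity
  have hnn : ∀ y ∈ Set.Ioi (0 : ℝ), 0 ≤ y ^ (d - 1) * (y ^ α * tailFun P₀ R y) := fun y hy => by
    have : 0 < y := hy
    have := tailFun_nonneg P₀ R y
    positivity
  have hint' : IntegrableOn (fun y : ℝ => y ^ (d - 1) * (y ^ α * tailFun P₀ R y)) (Set.Ioi 0) := by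
    have := (integrable_fun_norm_addHaar volume (E := EuclideanSpace ℝ (Fin d))
      (f := fun y => y ^ α * tailFun P₀ R y)).1 hint
    simpa only [finrank_euclideanSpace_fin, smul_eq_mul] using this
  -- Stated in `ℝ≥0∞`, this yields both finiteness of the moment and its value.
  have hlayer : ∫⁻ ω, ENNReal.ofReal ((R ω : ℝ) ^ (α + d)) ∂P₀ =
      ENNReal.ofReal ((α + d) *
        ∫ y in Set.Ioi (0 : ℝ), y ^ (d - 1) * (y ^ α * tailFun P₀ R y)) := by
    rw [lintegral_rpow_eq_lintegral_meas_le_mul P₀ (f := fun ω => (R ω : ℝ))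
      (ae_of_all _ fun ω => (R ω).2) (by fun_prop) hp, ENNReal.ofReal_mul hp.le,
      ofReal_integral_eq_lintegral_ofReal hint'
        ((ae_restrict_mem measurableSet_Ioi).mono hnn)]
    congr 1
    refine setLIntegral_congr_fun measurableSet_Ioi fun y hy => ?_
    have hy0 : 0 < y := hy
    have h1 : y ^ (d - 1) * (y ^ α * tailFun P₀ R y) = tailFun P₀ R y * y ^ (α + d - 1) := by
      rw [add_sub_assoc, Real.rpow_add hy0, ← Nat.cast_pred hd, Real.rpow_natCast]
      ring
    rw [h1, ENNReal.ofReal_mul (tailFun_nonneg P₀ R y), tailFun,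
      ofReal_measureReal (measure_ne_top _ _)]
  have hnnR : ∀ ω, 0 ≤ (R ω : ℝ) ^ (α + d) := fun ω => by positivity
  have hmR : AEStronglyMeasurable (fun ω => (R ω : ℝ) ^ (α + d)) P₀ :=
    (hR.coe_nnreal_real.pow_const _).aestronglyMeasurable
  refine ⟨⟨hmR, ?_⟩, ?_⟩
  · rw [hasFiniteIntegral_iff_ofReal (ae_of_all _ hnnR), hlayer]
    exact ENNReal.ofReal_lt_top
  · rw [integral_eq_lintegral_of_nonneg_ae (ae_of_all _ hnnR) hmR, hlayer,
      ENNReal.toReal_ofReal (mul_nonneg hp.le (setIntegral_nonneg measurableSet_Ioi hnn)),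
      integral_fun_norm_addHaar volume (fun y => y ^ α * tailFun P₀ R y),
      finrank_euclideanSpace_fin, unitBallVolume_eq_ball hd]
    simp only [nsmul_eq_mul, smul_eq_mul]
    field_simp

end ScaleFreeGilbert

open ScaleFreeGilbert

theorem theorem3 (d : ℕ) (hd : 2 ≤ d) (α β s : ℝ) (hα : 0 < α) (hβ : 0 < β) (hs : 0 < s)
    -- the typical mark
    {Ω₀ : Type*} [MeasurableSpace Ω₀] (P₀ : Measure Ω₀) [IsProbabilityMeasure P₀]
    (R : Ω₀ → ℝ≥0) (hR : Measurable R)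
    (hR_ac : P₀.map (fun ω => (R ω : ℝ)) ≪ volume)
    (hR_tail : Tendsto (fun h : ℝ => h ^ s * P₀.real {ω | h < (R ω : ℝ)}) atTop (𝓝 β))
    -- the marked Poisson processes on the tori
    {Ω : ℕ → Type*} [∀ n, MeasurableSpace (Ω n)] (P : ∀ n, Measure (Ω n))
    [∀ n, IsProbabilityMeasure (P n)]
    (X : ∀ n, ScaleFreeGilbert.MarkedPoints (Ω n) (ScaleFreeGilbert.Torus d n) ℝ≥0)
    (hX : ∀ n, 1 ≤ n → (X n).IsIndepMarkedPoisson
      (ScaleFreeGilbert.torusVolume d n) (P₀.map R) (P n)) :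
    (∀ n, 1 ≤ n → Integrable (ScaleFreeGilbert.inDegree α (X n)) (P n)) ∧
    (α + d < s →
      Integrable (fun ω => (R ω : ℝ) ^ (α + d)) P₀ ∧
      Tendsto (fun n : ℕ => ∫ ω, ScaleFreeGilbert.inDegree α (X n) ω ∂P n) atTop
        (𝓝 (d * ScaleFreeGilbert.unitBallVolume d / (α + d) *
          ∫ ω, (R ω : ℝ) ^ (α + d) ∂P₀))) ∧
    (s = α + d →
      Tendsto (fun n : ℕ =>
          (Real.log n)⁻¹ * ∫ ω, ScaleFreeGilbert.inDegree α (X n) ω ∂P n) atTop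
        (𝓝 (d * ScaleFreeGilbert.unitBallVolume d * β))) ∧
    (s < α + d →
      IntegrableOn (fun η : EuclideanSpace ℝ (Fin d) => ‖η‖ ^ (α - s))
        (ScaleFreeGilbert.unitCube d) ∧
      Tendsto (fun n : ℕ =>
          (n : ℝ) ^ (s - α - d) * ∫ ω, ScaleFreeGilbert.inDegree α (X n) ω ∂P n) atTop
        (𝓝 (β * ∫ η in ScaleFreeGilbert.unitCube d, ‖η‖ ^ (α - s)))) := by
  open ScaleFreeGilbert in
  have hd1 : 1 ≤ d := by omega
  have hG := antitone_tailFun P₀ R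
  have hG0 := tailFun_nonneg P₀ R
  have hG1 := tailFun_le_one P₀ R
  have hlim : Tendsto (fun t : ℝ => t ^ s * tailFun P₀ R t) atTop (𝓝 β) := by
    simpa only [tailFun_eq hR hR_ac] using hR_tail
  have hmean : ∀ᶠ n : ℕ in atTop, ∫ ω, inDegree α (X n) ω ∂P n =
      ∫ η in centeredCube d n, ‖η‖ ^ α * tailFun P₀ R ‖η‖ := by
    filter_upwards [eventually_ge_atTop 1] with n hn
    exact integral_inDegree hR hn α (hX n hn)
  refine ⟨fun n hn => integrable_inDegree hR hn hα.le (hX n hn), fun h => ?_, fun h => ?_,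
    fun h => ⟨integrableOn_rpow_norm_unitCube hd1 (by linarith), ?_⟩⟩
  · have hint := integrable_rpow_norm_mul hG hG0 hG1 hα.le hs h hlim
    obtain ⟨hRint, hval⟩ := integrable_rpow_mark_and_integral_eq hd1 hR hα hint
    refine ⟨hRint, ?_⟩
    rw [← hval, ← setIntegral_univ, ← iUnion_centeredCube_natCast d]
    refine (tendsto_setIntegral_of_monotone
      (fun n : ℕ => measurableSet_centeredCube d n)
      (fun m n hmn => monotone_centeredCube d (Nat.cast_le.2 hmn)) hint.integrableOn).congr' ?_
    exact hmean.mono fun n hn => hn.symm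
  · refine (tendsto_integral_centeredCube_of_eq hd1 hG hG0 hG1 hα.le h hlim).congr' ?_
    exact hmean.mono fun n hn => by simp only [hn]
  · refine (tendsto_integral_centeredCube_of_lt hd1 hG hG0 hG1 hs h hlim).congr' ?_
    exact hmean.mono fun n hn => by simp only [hn]
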